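/- Let $S$ be a finite set with a total order $<$, let $R$ be a commutative ring with $1$, and let $\mathfrak{M}\subseteq 2^S$ be the set of circuits of a loopless matroid without parallel elements on the ground set $S$. Write the elements of $J\subseteq S$ as $j_1<\cdots<j_{\#J}$. For $J,K\subseteq S$ write $J<_{\mathrm{dlex}}K$ if $\#J<\#K$, or if $\#J=\#K$, $J\neq K$ and the minimum of the symmetric difference of $J$ and $K$ lies in $J$. Write $K\sqsubseteq J$ if $K\subseteq J$ and every $j\in J$ with $k<j<k'$ for some $k,k'\in K$ lies in $K$. A subset of $S$ is dependent if it contains a member of $\mathfrak{M}$. The set $\overline{\mathfrak{M}}$ of Gröbner circuits is the set of dependent subsets of $S$ defined recursively along $<_{\mathrm{dlex}}$ as follows: a dependent set $J$ belongs to $\overline{\mathfrak{M}}$ if and only if there is no $K\in\overline{\mathfrak{M}}$ with $K<_{\mathrm{dlex}}J$ and $K\setminus\{k_1\}\sqsubseteq J\setminus\{j_1\}$. Let $A=R\langle t_s\mid s\in S\rangle$ be the free associative algebra, put $t_J=t_{j_1}\cdots t_{j_{\#J}}$ for $J\subseteq S$, and let $I_0(\mathfrak{M})$ be the two-sided ideal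 of $A$ generated by $t_s^2$ ($s\in S$), $t_rt_s+t_st_r$ ($r,s\in S$, $s<r$) and $\sum_{\nu=1}^{\#J}(-1)^{\nu-1}t_{J\setminus\{j_\nu\}}$ ($J\in\mathfrak{M}$), so that $A/I_0(\mathfrak{M})$ is the Orlik–Solomon algebra of $\mathfrak{M}$ over $R$. Let $E$ be the exterior algebra over $R$ on the generators $t_s$, $s\in S$, that is, the quotient of $A$ by the elements $t_s^2$ ($s\in S$) and $t_rt_s+t_st_r$ ($r,s\in S$, $s<r$); denote the image of $t_J$ in $E$ again by $t_J$, so that the $t_J$, $J\subseteq S$, form an $R$-basis of $E$. The defining ideal $I$ of the Orlik–Solomon algebra in $E$ is the image of $I_0(\mathfrak{M})$ in $E$. The leading term of a nonzero $f=\sum_J c_Jt_J\in E$ is $c_Jt_J$ for the $<_{\mathrm{dlex}}$-largest $J$ with $c_J\neq 0$. A subset $G\subseteq I$ is called a Gröbner basis of $I$ if the two-sided ideal of $E$ generated by the leading terms of the nonzero elements of $G$ coincides with the two-sided ideal generated by the leading terms of all nonzero elements of $I$. Then the elements $$\sum_{\nu=1}^{\#J}(-1)^{\nu-1}t_{J\setminus\{j_\nu\}},\qquad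 J\in\mathfrak{M}\cap\overline{\mathfrak{M}},$$ form a Gröbner basis of $I$ with respect to the degree lexicographic order. -/

import Mathlib

namespace OrlikSolomon

/-! ### Subsets of a totally ordered finite set -/

section Subsets

variable {S : Type*} [LinearOrder S]

/-- The strict degree lexicographic order on finite subsets: `J` comes before `K` if `J` has fewer
elements, or both have the same number of elements and the least element of the symmetric
difference of `J` and `K` lies in `J`. -/
def DegLexLT (J K : Finset S) : Prop :=
  J.card < K.card ∨
    (J.card = K.card ∧ ∃ x, x ∈ J ∧ x ∉ K ∧ ∀ y, y < x → (y ∈ J ↔ y ∈ K))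

theorem degLexLT_irrefl (J : Finset S) : ¬ DegLexLT J J := by
  rintro (h | ⟨-, x, hx, hx', -⟩)
  · exact lt_irrefl _ h
  · exact hx' hx

theorem degLexLT_trans {J K L : Finset S} (h₁ : DegLexLT J K) (h₂ : DegLexLT K L) :
    DegLexLT J L := by
  rcases h₁ with h₁ | ⟨h₁, x, hxJ, hxK, hx⟩
  · rcases h₂ with h₂ | ⟨h₂, -⟩
    · exact Or.inl (h₁.trans h₂)
    · exact Or.inl (h₂ ▸ h₁)
  · rcases h₂ with h₂ | ⟨h₂, y, hyK, hyL, hy⟩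
    · exact Or.inl (h₁ ▸ h₂)
    · refine Or.inr ⟨h₁.trans h₂, ?_⟩
      rcases lt_trichotomy x y with h | h | h
      · exact ⟨x, hxJ, fun hL => hxK ((hy x h).2 hL),
          fun z hz => (hx z hz).trans (hy z (hz.trans h))⟩
      · exact absurd (h ▸ hyK) hxK
      · exact ⟨y, (hx y h).2 hyK, hyL, fun z hz => (hx z (hz.trans h)).trans (hy z hz)⟩

theorem degLexLT_wellFounded [Finite S] : WellFounded (DegLexLT (S := S)) := by
  have : IsTrans (Finset S) DegLexLT := ⟨fun _ _ _ => degLexLT_trans⟩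
  have : Std.Irrefl (DegLexLT (S := S)) := ⟨degLexLT_irrefl⟩
  exact Finite.wellFounded_of_trans_of_irrefl _

/-- `J` without its least element. -/
def withoutMin (J : Finset S) : Finset S := J.filter (fun x => ∃ y ∈ J, y < x)

/-- `K` is a convex subset of `J`. -/
def IsConvexSubset (K J : Finset S) : Prop :=
  K ⊆ J ∧ ∀ j ∈ J, ∀ k ∈ K, ∀ k' ∈ K, k < j → j < k' → j ∈ K

/-- `J` is dependent in the set system `𝔐`: it contains a member of `𝔐`. -/
def IsDependent (𝔐 : Set (Finset S)) (J : Finset S) : Prop := ∃ C ∈ 𝔐, C ⊆ J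

/-- The set of Gröbner circuits of `𝔐`, defined by recursion along the degree lexicographic order;
the recursive description is `mem_groebnerCircuits`. -/
def groebnerCircuits [Finite S] (𝔐 : Set (Finset S)) : Set (Finset S) :=
  {J | degLexLT_wellFounded.fix (C := fun _ => Prop)
    (fun J ih => IsDependent 𝔐 J ∧
      ∀ K, ∀ h : DegLexLT K J, ih K h → ¬ IsConvexSubset (withoutMin K) (withoutMin J)) J}

theorem mem_groebnerCircuits [Finite S] (𝔐 : Set (Finset S)) (J : Finset S) :
    J ∈ groebnerCircuits 𝔐 ↔ IsDependent 𝔐 J ∧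
      ∀ K ∈ groebnerCircuits 𝔐, DegLexLT K J →
        ¬ IsConvexSubset (withoutMin K) (withoutMin J) := by
  have h : (J ∈ groebnerCircuits 𝔐) = (IsDependent 𝔐 J ∧
      ∀ K, DegLexLT K J → K ∈ groebnerCircuits 𝔐 →
        ¬ IsConvexSubset (withoutMin K) (withoutMin J)) :=
    degLexLT_wellFounded.fix_eq _ J
  rw [h]
  exact and_congr_right fun _ => forall_congr' fun K => ⟨fun h a b => h b a, fun h a b => h b a⟩

/-- The set of circuits of a matroid, as a set of finite sets. -/
def circuits (M : Matroid S) : Set (Finset S) := {J | M.IsCircuit (J : Set S)}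

end Subsets

/-! ### The Orlik-Solomon algebra -/

section Algebra

variable (R : Type*) [CommRing R] {S : Type*} [LinearOrder S]

/-- For elements `t s` of an `R`-algebra, the product of the `t j`, `j ∈ J`, in increasing order of
the indices. -/
noncomputable def orderedProd {B : Type*} [Ring B] (t : S → B) (J : Finset S) : B :=
  (J.sort.map t).prod

/-- The boundary `∑ ν, (-1) ^ (ν - 1) t_{J \ {j_ν}}` for `J = {j_1 < ⋯ < j_n}`: if `j = j_ν`, then
`ν - 1` is the number of elements of `J` below `j`. -/
noncomputable def boundary {B : Type*} [Ring B] (t : S → B) (J : Finset S) : B :=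
  ∑ j ∈ J, (-1) ^ (J.filter (· < j)).card * orderedProd t (J.erase j)

/-- The defining ideal, in the free associative algebra, of the Orlik-Solomon algebra over `R` of
the set system `𝔐`. -/
noncomputable def freeIdeal (𝔐 : Set (Finset S)) : TwoSidedIdeal (FreeAlgebra R S) :=
  TwoSidedIdeal.span
    ({x | ∃ s : S, x = FreeAlgebra.ι R s * FreeAlgebra.ι R s} ∪
      {x | ∃ r s : S, s < r ∧
        x = FreeAlgebra.ι R r * FreeAlgebra.ι R s + FreeAlgebra.ι R s * FreeAlgebra.ι R r} ∪
      {x | ∃ J ∈ 𝔐, x = boundary (FreeAlgebra.ι R) J})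

/-- The exterior algebra over `R` on the generators `t s`, `s : S`. -/
abbrev Ext (S : Type*) : Type _ := ExteriorAlgebra R (S →₀ R)

/-- The generator `t s` of the exterior algebra. -/
noncomputable def extGen (s : S) : Ext R S := ExteriorAlgebra.ι R (Finsupp.single s 1)

/-- The canonical surjection of the free associative algebra onto the exterior algebra. -/
noncomputable def toExt : FreeAlgebra R S →ₐ[R] Ext R S := FreeAlgebra.lift R (extGen R)

/-- The defining ideal of the Orlik-Solomon algebra in the exterior algebra. -/
noncomputable def extIdeal (𝔐 : Set (Finset S)) : TwoSidedIdeal (Ext R S) :=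
  (freeIdeal R 𝔐).map (toExt R)

/-- The boundary of `J` in the exterior algebra. -/
noncomputable def extBoundary (J : Finset S) : Ext R S := boundary (extGen R) J

/-- The basis of the exterior algebra that consists of the monomials
`orderedProd (extGen R) J`. -/
noncomputable def extBasis : Module.Basis (Finset S) R (Ext R S) :=
  (Finsupp.basisSingleOne (R := R) (ι := S)).ExteriorAlgebra

theorem extBasis_apply (J : Finset S) : extBasis R J = orderedProd (extGen R) J := by
  rw [extBasis, ExteriorAlgebra.basis_apply_ofCard _ rfl,
    ExteriorAlgebra.ιMulti_family, ExteriorAlgebra.ιMulti_apply, List.ofFn_eq_map,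
    orderedProd, ← Finset.listMap_orderEmbOfFin_finRange J rfl, List.map_map]
  congr 1

/-- `f` has leading monomial `J` (the largest one with nonzero coefficient, for the degree
lexicographic order) and leading term `u`. The zero element has none. -/
def IsLeadingTerm (f u : Ext R S) : Prop :=
  ∃ J : Finset S, (extBasis R).repr f J ≠ 0 ∧
    (∀ K, (extBasis R).repr f K ≠ 0 → K = J ∨ DegLexLT K J) ∧
    u = (extBasis R).repr f J • orderedProd (extGen R) J

/-- The set `G` is a Gröbner basis, for the degree lexicographic order, of the two-sided ideal `I`
of the exterior algebra: it lies in `I`, and the leading terms of `G` generate the same two-sided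
ideal as the leading terms of `I`. -/
def IsGroebnerBasis (G : Set (Ext R S)) (I : TwoSidedIdeal (Ext R S)) : Prop :=
  G ⊆ (I : Set (Ext R S)) ∧
    TwoSidedIdeal.span {u | ∃ g ∈ G, IsLeadingTerm R g u} =
      TwoSidedIdeal.span {u | ∃ f ∈ I, IsLeadingTerm R f u}

end Algebra

end OrlikSolomon

namespace OrlikSolomon

/-! ### Monomials, relabelling of generators, and the boundary -/

section Monomials

variable (R : Type*) [CommRing R] {S T : Type*}

/-! The leading monomial of the boundary of a circuit is its broken circuit, so it suffices that the
leading monomial `K` of any `f` in the ideal contains a broken circuit of a circuit that is a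
Gröbner circuit.

Suppose `K` contains no broken circuit. Then `K` is independent, and its upper segments span a flag;
`g = flagPosition M K` sends each element to its place in this flag. Relabelling generators along
`g` kills the ideal: on a circuit the least place is attained twice (`not_injOn_flagPosition`), so
the circuit's monomial maps to `0`, and so does its boundary, because the boundary is a contraction
that commutes with relabelling. All of `S` outside the closure of `K` goes to the one generator at
`⊥`, not to `0`, since the contraction must be `1` on every image.

On the other hand `g` fixes `K` and never increases an element that it sends into `K`, so no
monomial before `K` maps to `±t_K` (`not_degLexLT_of_image_eq`). The coefficient of `f` at `K`
therefore survives and must vanish, a contradiction.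

Passing to Gröbner circuits is a minimality argument
(`exists_mem_groebnerCircuits_withoutMin_subset`). -/

theorem extGen_mul_self (s : S) : extGen R s * extGen R s = 0 :=
  ExteriorAlgebra.ι_sq_zero _

theorem extGen_mul_swap (r s : S) : extGen R r * extGen R s = -(extGen R s * extGen R r) :=
  eq_neg_of_add_eq_zero_left (ExteriorAlgebra.ι_add_mul_swap _ _)

theorem prod_extGen_of_perm {l₁ l₂ : List S} (h : l₁.Perm l₂) :
    (l₁.map (extGen R)).prod = (l₂.map (extGen R)).prod ∨
      (l₁.map (extGen R)).prod = -(l₂.map (extGen R)).prod := by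
  induction h with
  | nil => exact Or.inl rfl
  | cons a _ ih =>
    simp only [List.map_cons, List.prod_cons]
    rcases ih with h | h <;> simp [h]
  | swap a b l =>
    right
    simp only [List.map_cons, List.prod_cons, ← mul_assoc]
    rw [extGen_mul_swap R b a, neg_mul]
  | trans _ _ ih₁ ih₂ =>
    rcases ih₁ with h | h <;> rcases ih₂ with h' | h' <;> simp [h, h']

theorem prod_extGen_eq_zero {l : List S} (h : ¬ l.Nodup) : (l.map (extGen R)).prod = 0 := by
  obtain ⟨a, ha⟩ := List.exists_duplicate_iff_not_nodup.2 h
  obtain ⟨l', hl'⟩ := (List.duplicate_iff_sublist.1 ha).exists_perm_append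
  have hz : (([a, a] ++ l').map (extGen R)).prod = 0 := by
    simp [← mul_assoc, extGen_mul_self]
  rcases prod_extGen_of_perm R hl' with h | h <;> rw [h, hz]
  exact neg_zero

/-- The homomorphism of exterior algebras induced by a map between the sets of generators. -/
noncomputable def relabel (g : S → T) : Ext R S →ₐ[R] Ext R T :=
  ExteriorAlgebra.map (Finsupp.lmapDomain R R g)

theorem relabel_extGen (g : S → T) (s : S) : relabel R g (extGen R s) = extGen R (g s) := by
  simp [relabel, extGen]

variable [LinearOrder S]

theorem prod_extGen_of_nodup {l : List S} (h : l.Nodup) :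
    (l.map (extGen R)).prod = orderedProd (extGen R) l.toFinset ∨
      (l.map (extGen R)).prod = -orderedProd (extGen R) l.toFinset := by
  refine prod_extGen_of_perm R ?_
  rw [List.perm_ext_iff_of_nodup h (Finset.sort_nodup _ _)]
  simp

theorem extBasis_repr_orderedProd (J : Finset S) :
    (extBasis R).repr (orderedProd (extGen R) J) = Finsupp.single J 1 := by
  rw [← extBasis_apply, Module.Basis.repr_self]

/-- Only the monomial of the set of its factors occurs in a product of generators. -/
theorem nodup_and_toFinset_eq_of_repr_ne_zero {l : List S} {K : Finset S}
    (h : (extBasis R).repr ((l.map (extGen R)).prod) K ≠ 0) : l.Nodup ∧ l.toFinset = K := by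
  by_cases hl : l.Nodup
  · refine ⟨hl, ?_⟩
    by_contra hK
    rcases prod_extGen_of_nodup R hl with h' | h' <;>
      simp [h', extBasis_repr_orderedProd, hK] at h
  · simp [prod_extGen_eq_zero R hl] at h

/-- Monomials are divisible by the monomials of subsets. -/
theorem orderedProd_mem_of_subset {I : TwoSidedIdeal (Ext R S)} {J K : Finset S} (h : J ⊆ K)
    (hJ : orderedProd (extGen R) J ∈ I) : orderedProd (extGen R) K ∈ I := by
  have hnd : (J.sort ++ (K \ J).sort).Nodup := by
    refine List.Nodup.append (Finset.sort_nodup _ _) (Finset.sort_nodup _ _) ?_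
    intro x hx hx'
    simp only [Finset.mem_sort, Finset.mem_sdiff] at hx hx'
    exact hx'.2 hx
  have hK : (J.sort ++ (K \ J).sort).toFinset = K := by
    ext x
    simp only [List.mem_toFinset, List.mem_append, Finset.mem_sort, Finset.mem_sdiff]
    exact ⟨fun hx => hx.elim (fun hx => h hx) And.left, fun hx => by tauto⟩
  have hmem : ((J.sort ++ (K \ J).sort).map (extGen R)).prod ∈ I := by
    rw [List.map_append, List.prod_append]
    exact I.mul_mem_right _ _ hJ
  rcases prod_extGen_of_nodup R hnd with h' | h'
  · rwa [h', hK] at hmem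
  · rw [h', hK] at hmem
    simpa using I.neg_mem hmem

theorem map_orderedProd {B C : Type*} [Ring B] [Ring C] (φ : B →+* C) (t : S → B)
    (J : Finset S) : φ (orderedProd t J) = orderedProd (φ ∘ t) J := by
  simp [orderedProd, map_list_prod]

theorem map_boundary {B C : Type*} [Ring B] [Ring C] (φ : B →+* C) (t : S → B)
    (J : Finset S) : φ (boundary t J) = boundary (φ ∘ t) J := by
  simp [boundary, map_orderedProd]

theorem orderedProd_insert {B : Type*} [Ring B] (t : S → B) {a : S} {J : Finset S}
    (h : ∀ x ∈ J, a < x) : orderedProd t (insert a J) = t a * orderedProd t J := by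
  rw [orderedProd, Finset.sort_insert _ (fun b hb => (h b hb).le) (fun ha => (h a ha).false),
    List.map_cons, List.prod_cons, orderedProd]

theorem boundary_insert {B : Type*} [Ring B] (t : S → B) {a : S} {J : Finset S}
    (h : ∀ x ∈ J, a < x) :
    boundary t (insert a J) = orderedProd t J - t a * boundary t J := by
  have ha : a ∉ J := fun ha => (h a ha).false
  rw [boundary, Finset.sum_insert ha, Finset.erase_insert ha, sub_eq_add_neg, boundary,
    Finset.mul_sum, ← Finset.sum_neg_distrib]
  congr 1
  · rw [Finset.filter_false_of_mem]
    · simp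
    · intro x hx
      rcases Finset.mem_insert.1 hx with rfl | hx
      · exact lt_irrefl _
      · exact (h x hx).not_gt
  · refine Finset.sum_congr rfl fun j hj => ?_
    rw [Finset.filter_insert, if_pos (h j hj), Finset.card_insert_of_notMem (by simp [ha]),
      Finset.erase_insert_of_ne (h j hj).ne,
      orderedProd_insert t (fun x hx => h x (Finset.mem_of_mem_erase hx)), ← mul_assoc,
      ← mul_assoc, ← neg_mul, pow_succ, mul_neg_one, neg_mul, neg_mul,
      ((Commute.neg_one_left (t a)).pow_left _).eq, neg_mul]

/-- The boundary is the contraction with a functional that is `1` on all generators. -/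
theorem boundary_eq_contractLeft {M : Type*} [AddCommGroup M] [Module R M] (d : Module.Dual R M)
    (v : S → M) (hv : ∀ s, d (v s) = 1) (J : Finset S) :
    boundary (fun s => ExteriorAlgebra.ι R (v s)) J =
      CliffordAlgebra.contractLeft d (orderedProd (fun s => ExteriorAlgebra.ι R (v s)) J) := by
  induction J using Finset.induction_on_min with
  | empty => exact (by simp [boundary, orderedProd])
  | insert a J h ih =>
    rw [boundary_insert _ h, orderedProd_insert _ h, ih]
    erw [CliffordAlgebra.contractLeft_ι_mul]
    rw [hv, one_smul]

theorem relabel_orderedProd (g : S → T) (J : Finset S) :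
    relabel R g (orderedProd (extGen R) J) = ((J.sort.map g).map (extGen R)).prod := by
  rw [orderedProd, map_list_prod, List.map_map, List.map_map]
  congr 2
  exact funext fun s => relabel_extGen R g s

/-- The image of `t_J` has a repeated factor, hence is `0`; the image of the boundary is the
contraction of that image with the sum of coordinates. -/
theorem relabel_extBoundary_eq_zero (g : S → T) {J : Finset S} (h : ¬ Set.InjOn g J) :
    relabel R g (extBoundary R J) = 0 := by
  have hgen : (relabel R g : Ext R S →+* Ext R T) ∘ extGen R =
      fun s => ExteriorAlgebra.ι R (Finsupp.single (g s) 1) :=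
    funext fun s => relabel_extGen R g s
  have hprod := relabel_orderedProd R g J
  rw [prod_extGen_eq_zero] at hprod
  · have hb := map_boundary (relabel R g : Ext R S →+* Ext R T) (extGen R) J
    have hp := map_orderedProd (relabel R g : Ext R S →+* Ext R T) (extGen R) J
    rw [hgen] at hb hp
    rw [boundary_eq_contractLeft R (Finsupp.linearCombination R fun _ => (1 : R)) _ (by simp),
      ← hp] at hb
    have hp' : (relabel R g : Ext R S →+* Ext R T) (orderedProd (extGen R) J) = 0 := hprod
    rw [hp', map_zero] at hb
    exact hb
  · intro hnd
    refine h fun x hx y hy hxy => ?_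
    exact List.inj_on_of_nodup_map hnd (by simpa using hx) (by simpa using hy) hxy

theorem relabel_eq_zero_of_mem_extIdeal (g : S → T) {𝔐 : Set (Finset S)}
    (h : ∀ J ∈ 𝔐, ¬ Set.InjOn g J) {f : Ext R S} (hf : f ∈ extIdeal R 𝔐) :
    relabel R g f = 0 := by
  have hgen (s : S) : toExt R (FreeAlgebra.ι R s) = extGen R s := by simp [toExt]
  have hb (J : Finset S) : toExt R (boundary (FreeAlgebra.ι R) J) = extBoundary R J := by
    refine (map_boundary (toExt R (S := S) : FreeAlgebra R S →+* Ext R S) _ J).trans ?_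
    rw [extBoundary]
    congr 1
    exact funext hgen
  have hfree : freeIdeal R 𝔐 ≤ TwoSidedIdeal.ker ((relabel R g).comp (toExt R)) := by
    rw [freeIdeal, TwoSidedIdeal.span_le]
    rintro x ((⟨s, rfl⟩ | ⟨r, s, -, rfl⟩) | ⟨J, hJ, rfl⟩) <;>
      rw [SetLike.mem_coe, TwoSidedIdeal.mem_ker, AlgHom.comp_apply]
    · rw [map_mul, hgen, extGen_mul_self, map_zero]
    · rw [map_add, map_mul, map_mul, hgen, hgen, extGen_mul_swap R r s, neg_add_cancel, map_zero]
    · rw [hb, relabel_extBoundary_eq_zero R g (h J hJ)]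
  have hle : extIdeal R 𝔐 ≤ TwoSidedIdeal.ker (relabel R g) := by
    rw [extIdeal, TwoSidedIdeal.map, TwoSidedIdeal.span_le]
    rintro _ ⟨x, hx, rfl⟩
    have := hfree hx
    rw [TwoSidedIdeal.mem_ker] at this
    exact (TwoSidedIdeal.mem_ker _).2 this
  exact (TwoSidedIdeal.mem_ker _).1 (hle hf)

theorem extBoundary_mem_extIdeal {𝔐 : Set (Finset S)} {J : Finset S} (hJ : J ∈ 𝔐) :
    extBoundary R J ∈ extIdeal R 𝔐 := by
  refine TwoSidedIdeal.subset_span ⟨boundary (FreeAlgebra.ι R) J,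
    TwoSidedIdeal.subset_span (Or.inr ⟨J, hJ, rfl⟩), ?_⟩
  refine (map_boundary (toExt R (S := S) : FreeAlgebra R S →+* Ext R S) _ J).trans ?_
  rw [extBoundary]
  congr 1
  exact funext fun s => by simp [toExt]

end Monomials

/-! ### Leading terms of boundaries -/

section LeadingTerms

variable (R : Type*) [CommRing R] {S : Type*} [LinearOrder S]

theorem withoutMin_eq_erase_min' (J : Finset S) (h : J.Nonempty) :
    withoutMin J = J.erase (J.min' h) := by
  ext x
  simp only [withoutMin, Finset.mem_filter, Finset.mem_erase]
  constructor
  · rintro ⟨hx, y, hy, hyx⟩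
    exact ⟨((J.min'_le y hy).trans_lt hyx).ne', hx⟩
  · rintro ⟨hne, hx⟩
    exact ⟨hx, _, J.min'_mem h, lt_of_le_of_ne (J.min'_le x hx) hne.symm⟩

theorem degLexLT_erase {J : Finset S} {i j : S} (hi : i ∈ J) (hj : j ∈ J) (h : i < j) :
    DegLexLT (J.erase j) (J.erase i) := by
  refine Or.inr ⟨by rw [Finset.card_erase_of_mem hi, Finset.card_erase_of_mem hj], i, ?_⟩
  refine ⟨Finset.mem_erase.2 ⟨h.ne, hi⟩, by simp, fun y hy => ?_⟩
  simp [hy.ne, (hy.trans h).ne]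

theorem isLeadingTerm_extBoundary [Nontrivial R] {J : Finset S} (h : J.Nonempty) :
    IsLeadingTerm R (extBoundary R J) (orderedProd (extGen R) (withoutMin J)) := by
  have hrepr (K : Finset S) : (extBasis R).repr (extBoundary R J) K =
      ∑ j ∈ J, if J.erase j = K then (-1 : R) ^ (J.filter (· < j)).card else 0 := by
    have hs : extBoundary R J = ∑ j ∈ J,
        ((-1 : R) ^ (J.filter (· < j)).card) • orderedProd (extGen R) (J.erase j) := by
      rw [extBoundary, boundary]
      exact Finset.sum_congr rfl fun j _ => by rw [Algebra.smul_def]; simp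
    rw [hs, map_sum, Finsupp.finsetSum_apply]
    refine Finset.sum_congr rfl fun j _ => ?_
    rw [map_smul, extBasis_repr_orderedProd, Finsupp.smul_apply, Finsupp.single_apply]
    simp
  have hmin := J.min'_mem h
  have hone : (extBasis R).repr (extBoundary R J) (withoutMin J) = 1 := by
    rw [hrepr, withoutMin_eq_erase_min' J h, Finset.sum_eq_single_of_mem _ hmin]
    · rw [if_pos rfl, Finset.filter_false_of_mem fun x hx => (J.min'_le x hx).not_gt]
      simp
    · intro j hj hne
      refine if_neg fun he => ?_
      have : J.min' h ∈ J.erase j := Finset.mem_erase.2 ⟨hne.symm, hmin⟩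
      rw [he] at this
      simp at this
  refine ⟨withoutMin J, by rw [hone]; exact one_ne_zero, fun K hK => ?_, by rw [hone, one_smul]⟩
  rw [hrepr] at hK
  obtain ⟨j, hj, hjK⟩ := Finset.exists_ne_zero_of_sum_ne_zero hK
  obtain rfl : J.erase j = K := by
    by_contra hne
    exact hjK (if_neg hne)
  rw [withoutMin_eq_erase_min' J h]
  rcases (J.min'_le j hj).eq_or_lt with he | hlt
  · exact Or.inl (by rw [he])
  · exact Or.inr (degLexLT_erase hmin hj hlt)

end LeadingTerms

/-! ### Broken circuits and the flag of an independent set -/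

section Matroids

variable {S : Type*} [LinearOrder S]

theorem withoutMin_subset (J : Finset S) : withoutMin J ⊆ J := Finset.filter_subset _ _

theorem withoutMin_mono {J K : Finset S} (h : J ⊆ K) : withoutMin J ⊆ withoutMin K := by
  intro x hx
  obtain ⟨hxJ, y, hy, hyx⟩ := Finset.mem_filter.1 hx
  exact Finset.mem_filter.2 ⟨h hxJ, y, h hy, hyx⟩

/-- Every broken circuit contains the broken circuit of some circuit that is a Gröbner circuit. -/
theorem exists_mem_groebnerCircuits_withoutMin_subset [Finite S] {𝔐 : Set (Finset S)}
    {J : Finset S} (hJ : J ∈ 𝔐) :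
    ∃ C ∈ 𝔐 ∩ groebnerCircuits 𝔐, withoutMin C ⊆ withoutMin J := by
  obtain ⟨C, ⟨hC, hCJ⟩, hmin⟩ := degLexLT_wellFounded.has_min
    {C | C ∈ 𝔐 ∧ withoutMin C ⊆ withoutMin J} ⟨J, hJ, subset_rfl⟩
  refine ⟨C, ⟨hC, (mem_groebnerCircuits 𝔐 C).2 ⟨⟨C, hC, subset_rfl⟩, ?_⟩⟩, hCJ⟩
  intro K hK hKC hconv
  -- An excluding `K` is only dependent, but a circuit inside it would be an earlier competitor to
  -- `C`.
  obtain ⟨D, hD, hDK⟩ := ((mem_groebnerCircuits 𝔐 K).1 hK).1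
  refine hmin D ⟨hD, ((withoutMin_mono hDK).trans hconv.1).trans hCJ⟩ ?_
  rcases hDK.eq_or_ssubset with rfl | hss
  · exact hKC
  · exact degLexLT_trans (Or.inl (Finset.card_lt_card hss)) hKC

open Classical in
/-- The position of `s` in the flag of the closures of the upper segments of `K`: the largest
`k ∈ K` such that `s` lies in the closure of the elements of `K` from `k` on, or `⊥` if `s` is not
in the closure of `K`. -/
noncomputable def flagPosition (M : Matroid S) (K : Finset S) (s : S) : WithBot S :=
  (K.filter fun k => s ∈ M.closure {x | x ∈ K ∧ k ≤ x}).max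

variable {M : Matroid S} {K : Finset S}

open Classical in
theorem mem_and_mem_closure_of_flagPosition_eq {s k : S} (h : flagPosition M K s = k) :
    k ∈ K ∧ s ∈ M.closure {x | x ∈ K ∧ k ≤ x} :=
  Finset.mem_filter.1 (Finset.mem_of_max h)

open Classical in
theorem le_flagPosition {s k : S} (hk : k ∈ K) (hs : s ∈ M.closure {x | x ∈ K ∧ k ≤ x}) :
    (k : WithBot S) ≤ flagPosition M K s :=
  Finset.le_max (Finset.mem_filter.2 ⟨hk, hs⟩)

/-- If `x` alone had the least position on `C`, the rest of `C` would lie in the flag member at the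
second least position `k`. That member is closed, so it contains `x` too, and `x` has position at
least `k`. -/
theorem not_injOn_flagPosition (K : Finset S) {C : Finset S}
    (hC : M.IsCircuit (C : Set S)) (hnt : (C : Set S).Nontrivial) :
    ¬ Set.InjOn (flagPosition M K) C := by
  intro hinj
  obtain ⟨x, hx, hmin⟩ := C.exists_min_image (flagPosition M K)
    (Finset.coe_nonempty.1 hnt.nonempty)
  have hlt : ∀ y ∈ C.erase x, flagPosition M K x < flagPosition M K y := fun y hy =>
    lt_of_le_of_ne (hmin y (Finset.mem_of_mem_erase hy)) fun he =>
      Finset.ne_of_mem_erase hy (hinj hx (Finset.mem_of_mem_erase hy) he).symm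
  obtain ⟨y, hy, hyx⟩ := hnt.exists_ne x
  obtain ⟨z, hz, hzmin⟩ := (C.erase x).exists_min_image (flagPosition M K)
    ⟨y, Finset.mem_erase.2 ⟨hyx, hy⟩⟩
  obtain ⟨k, hk⟩ := WithBot.ne_bot_iff_exists.1 (bot_le.trans_lt (hlt z hz)).ne'
  have hkK := (mem_and_mem_closure_of_flagPosition_eq hk.symm).1
  have hsub : (C : Set S) \ {x} ⊆ M.closure {x | x ∈ K ∧ k ≤ x} := by
    intro w hw
    have hw' : w ∈ C.erase x := Finset.mem_erase.2 ⟨hw.2, hw.1⟩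
    obtain ⟨l, hl⟩ := WithBot.ne_bot_iff_exists.1 (bot_le.trans_lt (hlt w hw')).ne'
    have hkl : k ≤ l := by
      have := hzmin w hw'
      rw [← hk, ← hl] at this
      exact WithBot.coe_le_coe.1 this
    have hseg : {x | x ∈ K ∧ l ≤ x} ⊆ {x | x ∈ K ∧ k ≤ x} :=
      fun v hv => ⟨hv.1, hkl.trans hv.2⟩
    exact M.closure_subset_closure hseg (mem_and_mem_closure_of_flagPosition_eq hl.symm).2
  have hxcl := M.closure_subset_closure_of_subset_closure hsub
    (hC.mem_closure_sdiff_singleton_of_mem hx)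
  exact absurd (le_flagPosition hkK hxcl) (not_le.2 (hk ▸ hlt z hz))

/-- A set that contains no broken circuit is independent. -/
theorem indep_of_no_broken_circuit (hE : M.E = Set.univ)
    (hK : ∀ C ∈ circuits M, ¬ withoutMin C ⊆ K) : M.Indep (K : Set S) := by
  rw [Matroid.indep_iff_forall_subset_not_isCircuit (by simp [hE])]
  intro C hCK hC
  lift C to Finset S using K.finite_toSet.subset hCK
  exact hK C hC ((withoutMin_subset C).trans (by exact_mod_cast hCK))

open Classical in
theorem flagPosition_of_mem (hE : M.E = Set.univ) (hK : M.Indep (K : Set S)) {k : S}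
    (hk : k ∈ K) : flagPosition M K k = k := by
  refine le_antisymm ?_ (le_flagPosition hk
    (M.mem_closure_of_mem (show k ∈ {x | x ∈ K ∧ k ≤ x} from ⟨hk, le_rfl⟩) (by simp [hE])))
  refine Finset.max_le fun l hl => WithBot.coe_le_coe.2 (not_lt.1 fun hkl => ?_)
  -- A position `l > k` would put `k` in the closure of `K` without `k`.
  refine hK.notMem_closure_sdiff_of_mem hk
    (M.closure_subset_closure ?_ (Finset.mem_filter.1 hl).2)
  rintro x ⟨hx, hlx⟩
  exact ⟨hx, (hkl.trans_le hlx).ne'⟩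

/-- If `s < k`, a circuit through `s` in `s` and the segment of `K` from `k` on has least element
`s`, so its broken circuit lies in `K`. -/
theorem le_of_flagPosition_eq (hK : ∀ C ∈ circuits M, ¬ withoutMin C ⊆ K) {s k : S}
    (h : flagPosition M K s = k) : k ≤ s := by
  by_contra! hsk
  obtain ⟨C, hCsub, hC, hsC⟩ := Matroid.exists_isCircuit_of_mem_closure
    (mem_and_mem_closure_of_flagPosition_eq h).2 (fun hs => hs.2.not_gt hsk)
  lift C to Finset S using
    ((K.finite_toSet.subset fun x (hx : x ∈ {x | x ∈ K ∧ k ≤ x}) => hx.1).insert s).subset hCsub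
  refine hK C hC fun y hy => ?_
  obtain ⟨hyC, z, hz, hzy⟩ := Finset.mem_filter.1 hy
  rcases hCsub hyC with rfl | hyK
  · rcases hCsub hz with rfl | hzK
    · exact absurd hzy (lt_irrefl _)
    · exact absurd (hzy.trans hsk) hzK.2.not_gt
  · exact hyK.1

/-- If a map `g` fixes the elements of `K` and does not increase the elements that it maps into
`K`, then no set before `K` maps bijectively onto `K`. -/
theorem not_degLexLT_of_image_eq {g : S → WithBot S} (hfix : ∀ k ∈ K, g k = k)
    (hle : ∀ s k : S, g s = k → k ≤ s) {J : Finset S} (hinj : Set.InjOn g J)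
    (himage : J.image g = K.image (↑)) : ¬ DegLexLT J K := by
  rintro (hcard | ⟨-, x, hxJ, hxK, hx⟩)
  · rw [← Finset.card_image_of_injOn hinj, himage,
      Finset.card_image_of_injective _ WithBot.coe_injective] at hcard
    exact hcard.false
  · obtain ⟨k, hk, hkx⟩ := Finset.mem_image.1 (himage ▸ Finset.mem_image_of_mem g hxJ)
    have hlt : k < x := lt_of_le_of_ne (hle x k hkx.symm) fun he => hxK (he ▸ hk)
    exact hlt.ne (hinj ((hx k hlt).2 hk) hxJ ((hfix k hk).trans hkx))

end Matroids

/-! ### Leading monomials of the ideal and the main theorem -/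

/-- The leading monomial of an element of the Orlik-Solomon ideal contains a broken circuit. -/
theorem exists_withoutMin_subset_of_mem_extIdeal (R : Type*) [CommRing R] {S : Type*} [Finite S]
    [LinearOrder S] {M : Matroid S} (hE : M.E = Set.univ) (hloop : M.Loopless) {f : Ext R S}
    (hf : f ∈ extIdeal R (circuits M)) {K : Finset S} (hfK : (extBasis R).repr f K ≠ 0)
    (hmax : ∀ J, (extBasis R).repr f J ≠ 0 → J = K ∨ DegLexLT J K) :
    ∃ C ∈ circuits M, withoutMin C ⊆ K := by
  by_contra! hK
  have hfix : ∀ k ∈ K, flagPosition M K k = k := fun k hk =>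
    flagPosition_of_mem hE (indep_of_no_broken_circuit hE hK) hk
  have hzero := relabel_eq_zero_of_mem_extIdeal R (flagPosition M K) (fun C hC =>
    not_injOn_flagPosition K hC (Matroid.loopless_iff_forall_isCircuit.1 hloop _ hC)) hf
  have := Fintype.ofFinite S
  rw [← (extBasis R).sum_repr f, map_sum] at hzero
  have hcoeff := congrArg (fun w => (extBasis R).repr w (K.image (↑))) hzero
  simp only [map_sum, map_smul, Finsupp.finsetSum_apply, Finsupp.smul_apply, extBasis_apply,
    relabel_orderedProd, map_zero, Finsupp.zero_apply] at hcoeff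
  -- Only the term of `f` at `K` can contribute to the coefficient at the image of `K`.
  rw [Finset.sum_eq_single_of_mem K (Finset.mem_univ K)] at hcoeff
  · have hsort : (K.sort.map (flagPosition M K)) = (K.image ((↑) : S → WithBot S)).sort := by
      rw [List.map_congr_left (g := ((↑) : S → WithBot S))
        fun k hk => hfix k ((Finset.mem_sort _).1 hk)]
      have hnd : (K.sort.map ((↑) : S → WithBot S)).Nodup :=
        (Finset.sort_nodup _ _).map WithBot.coe_injective
      have himg : (K.sort.map ((↑) : S → WithBot S)).toFinset = K.image (↑) := by
        ext; simp
      rw [← himg]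
      refine ((List.toFinset_sort (· ≤ ·) hnd).2 ?_).symm
      rw [List.pairwise_map]
      exact (Finset.pairwise_sort K (· ≤ ·)).imp fun h => WithBot.coe_le_coe.2 h
    rw [hsort] at hcoeff
    change _ • (extBasis R).repr (orderedProd (extGen R) _) _ = 0 at hcoeff
    rw [extBasis_repr_orderedProd] at hcoeff
    simp at hcoeff
    exact hfK hcoeff
  · intro J _ hJK
    by_contra hne
    obtain ⟨hnd, himage⟩ := nodup_and_toFinset_eq_of_repr_ne_zero R (right_ne_zero_of_smul hne)
    refine not_degLexLT_of_image_eq hfix (fun s k => le_of_flagPosition_eq hK) (J := J) ?_ ?_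
      ((hmax J (left_ne_zero_of_smul hne)).resolve_left hJK)
    · intro x hx y hy hxy
      exact List.inj_on_of_nodup_map hnd (by simpa using hx) (by simpa using hy) hxy
    · rw [← himage]
      ext
      simp

end OrlikSolomon

theorem corollary1p6 (R : Type*) [CommRing R] {S : Type*} [Finite S] [LinearOrder S]
    (M : Matroid S) (hE : M.E = Set.univ) (hloop : M.Loopless)
    (hpar : ∀ e f : S, e ≠ f → ¬ M.IsCircuit {e, f}) :
    OrlikSolomon.IsGroebnerBasis R
      (OrlikSolomon.extBoundary R ''
        (OrlikSolomon.circuits M ∩ OrlikSolomon.groebnerCircuits (OrlikSolomon.circuits M)))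
      (OrlikSolomon.extIdeal R (OrlikSolomon.circuits M)) := by
  have hsub : OrlikSolomon.extBoundary R ''
      (OrlikSolomon.circuits M ∩ OrlikSolomon.groebnerCircuits (OrlikSolomon.circuits M)) ⊆
      (OrlikSolomon.extIdeal R (OrlikSolomon.circuits M) : Set (OrlikSolomon.Ext R S)) := by
    rintro _ ⟨J, hJ, rfl⟩
    exact OrlikSolomon.extBoundary_mem_extIdeal R hJ.1
  refine ⟨hsub, le_antisymm (TwoSidedIdeal.span_mono ?_) (TwoSidedIdeal.span_le.2 ?_)⟩
  · rintro u ⟨g, hg, hu⟩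
    exact ⟨g, hsub hg, hu⟩
  · rintro u ⟨f, hf, K, hfK, hmax, rfl⟩
    -- Over the zero ring nothing has a leading term; here a nonzero coefficient is at hand.
    have : Nontrivial R := ⟨⟨_, _, hfK⟩⟩
    obtain ⟨J, hJ, hJK⟩ :=
      OrlikSolomon.exists_withoutMin_subset_of_mem_extIdeal R hE hloop hf hfK hmax
    obtain ⟨C, hC, hCJ⟩ := OrlikSolomon.exists_mem_groebnerCircuits_withoutMin_subset hJ
    rw [SetLike.mem_coe, Algebra.smul_def]
    refine TwoSidedIdeal.mul_mem_left _ _ _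
      (OrlikSolomon.orderedProd_mem_of_subset R (hCJ.trans hJK) ?_)
    exact TwoSidedIdeal.subset_span ⟨_, Set.mem_image_of_mem _ hC,
      OrlikSolomon.isLeadingTerm_extBoundary R
        (Finset.coe_nonempty.1 (Matroid.IsCircuit.nonempty hC.1))⟩
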